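/- Let $\Bbbk$ be a field and let $K_0\to K_1\to\cdots\to K_N$ ($N\ge 0$) be a finite sequence of continuous maps of topological spaces such that $H_q(K_i)=H_q(K_i;\Bbbk)$ (singular homology) is finite dimensional for all $i$ and $q$. For $i\le j$ let $f^{i,j}\colon H_*(K_i)\to H_*(K_j)$ be the map induced by the composite $K_i\to\cdots\to K_j$. For each $i$ fix a transfer diagram from the singular chains $(C_*(K_i),d)$ onto $(H_*(K_i),0)$: chain maps $\pi\colon C_*(K_i)\to H_*(K_i)$, $\iota\colon H_*(K_i)\to C_*(K_i)$ and a map $\phi\colon C_*(K_i)\to C_{*+1}(K_i)$ with $\pi\iota=\mathrm{id}$, $\phi d+d\phi=\iota\pi-\mathrm{id}$, $\pi\phi=0$, $\phi\iota=0$, $\phi^2=0$, where $\pi$ sends each cycle to its homology class. Endow $H_*(K_i)$ with the $A_\infty$-coalgebra structure $\{\Delta_n\colon H_*(K_i)\to H_*(K_i)^{\otimes n}\}_{n\ge1}$ obtained through this diagram by homotopy transfer from the Alexander–Whitney diagonal $\Delta\colon C_*(K_i)\to C_*(K_i)\otimes C_*(K_i)$. Explicitly, with the Koszul sign rule, put $P_{(1)}=\pi$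 and, for $n\ge2$, $$\widetilde\Delta_n=\sum_{\substack{r+s=n\\ r,s\ge1}}(-1)^{s+1}\,(P_{(r)}\otimes P_{(s)})\circ\Delta,\qquad P_{(n)}=\widetilde\Delta_n\circ\phi,\qquad \Delta_n=\widetilde\Delta_n\circ\iota,$$ and $\Delta_1=0$. For $n\ge1$, $p\ge0$ and $0\le i\le j\le N$ let $$(\Delta_n)^{i,j}_p=f^{i,j}\Bigl(\,\bigcap_{k=i}^{j}\ker\bigl(\Delta_n\circ f^{i,k}\colon H_p(K_i)\to H_*(K_k)^{\otimes n}\bigr)\Bigr)\subseteq H_p(K_j),$$ and call a class $\alpha\in H_p(K_i)$ *$\Delta_n$-awake at $K_k$* ($k\ge i$) if $f^{i,k}\alpha\ne0$ and $\Delta_n f^{i,k}\alpha=0$. **Theorem.** For every $n\ge1$ and $p\ge0$ there is a basis $\mathcal B$ of the graded vector space $\bigoplus_{i=0}^N H_*(K_i)$, consisting of homogeneous elements (each lying in some $H_q(K_i)$), such that for all $0\le i\le j\le N$ $$\dim(\Delta_n)^{i,j}_p=\#\{\beta\in\mathcal B\cap H_p(K_i)\;:\;\beta\text{ is }\Delta_n\text{-awake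 at }K_k\text{ for every }k=i,\dots,j\}.$$ -/

import Mathlib

open CategoryTheory DirectSum
open scoped TensorProduct

universe u

noncomputable section

namespace AInfPersistence

/-! ### Singular chains, singular homology and the Alexander-Whitney diagonal -/

section Chains

open scoped Simplicial

variable (k : Type u) [Field k]

/-- The singular chain complex `C_*(X)` of a space with coefficients in the field `k`. -/
abbrev singularChains (X : TopCat.{u}) : ChainComplex (ModuleCat.{u} k) ℕ :=
  ((AlgebraicTopology.singularChainComplexFunctor (ModuleCat.{u} k)).obj (ModuleCat.of k k)).obj X

/-- The singular homology `H_q(X)` with coefficients in the field `k`. -/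
abbrev Homology (X : TopCat.{u}) (q : ℕ) : ModuleCat.{u} k :=
  (singularChains k X).homology q

/-- The map `H_q(X) → H_q(Y)` induced by a continuous map. -/
def homMap {X Y : TopCat.{u}} (f : X ⟶ Y) (q : ℕ) : Homology k X q →ₗ[k] Homology k Y q :=
  (HomologicalComplex.homologyMap
    (((AlgebraicTopology.singularChainComplexFunctor (ModuleCat.{u} k)).obj
      (ModuleCat.of k k)).map f) q).hom

/-- The total space `⨁ q, C_q(X)` of the singular chains. -/
abbrev TotalChains (X : TopCat.{u}) : Type u := ⨁ q : ℕ, (singularChains k X).X q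

/-- The total homology `H_*(X) = ⨁ q, H_q(X)`. -/
abbrev TotalHom (X : TopCat.{u}) : Type u := ⨁ q : ℕ, Homology k X q

/-- The generator of the singular chains given by a singular simplex. -/
def simplexChain (X : TopCat.{u}) {n : ℕ} (x : (TopCat.toSSet.obj X) _⦋n⦌) : TotalChains k X :=
  DirectSum.lof k ℕ (fun q => (singularChains k X).X q) n
    ((SSet.ιChainComplex (R := ModuleCat.of k k) (TopCat.toSSet.obj X) x).hom (1 : k))

/-- The face `[v_j, …, v_{j+l}]` of a singular `n`-simplex. -/
def subface (X : TopCat.{u}) {n : ℕ} (j l : ℕ) (h : j + l ≤ n)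
    (x : (TopCat.toSSet.obj X) _⦋n⦌) : (TopCat.toSSet.obj X) _⦋l⦌ :=
  (TopCat.toSSet.obj X).map (SimplexCategory.subinterval j l h).op x

/-- The Alexander-Whitney diagonal on a simplex:
`∑_{a+b=n} [v_0, …, v_a] ⊗ [v_a, …, v_n]`. -/
def awSimplex (X : TopCat.{u}) {n : ℕ} (x : (TopCat.toSSet.obj X) _⦋n⦌) :
    TotalChains k X ⊗[k] TotalChains k X :=
  ∑ a : Fin (n + 1),
    simplexChain k X (subface X 0 a.1 (by omega) x) ⊗ₜ[k]
      simplexChain k X (subface X a.1 (n - a.1) (by omega) x)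

/-- The Alexander-Whitney diagonal `C_*(X) → C_*(X) ⊗ C_*(X)`, the linear extension of
`awSimplex`. -/
def awDiagonal (X : TopCat.{u}) :
    TotalChains k X →ₗ[k] TotalChains k X ⊗[k] TotalChains k X :=
  DirectSum.toModule k ℕ _ fun n =>
    (Limits.Cofan.IsColimit.desc
      (SSet.isColimitChainComplexXCofan (TopCat.toSSet.obj X) (ModuleCat.of k k) n)
      (fun x => ModuleCat.ofHom
        (Y := TotalChains k X ⊗[k] TotalChains k X)
        (LinearMap.toSpanSingleton k _ (awSimplex k X x)))).hom

end Chains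

/-! ### Transfer diagrams and the transferred structure -/

variable {k : Type u} [Field k]

/-- A transfer diagram from a chain complex `C` onto its homology (with zero differential):
chain maps `proj : C → H_*(C)`, `incl : H_*(C) → C` and a degree one homotopy `htpy` on `C` with
`proj ∘ incl = id`, `htpy ∘ d + d ∘ htpy = incl ∘ proj - id` and the side conditions
`proj ∘ htpy = 0`, `htpy ∘ incl = 0`, `htpy ∘ htpy = 0`.  The identification with the homology
is the canonical one: `proj` sends a cycle to its homology class. -/
structure TransferDiagram (C : ChainComplex (ModuleCat.{u} k) ℕ) where
  proj : ∀ q : ℕ, C.X q ⟶ C.homology q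
  incl : ∀ q : ℕ, C.homology q ⟶ C.X q
  htpy : ∀ q : ℕ, C.X q ⟶ C.X (q + 1)
  d_proj : ∀ q r : ℕ, C.d q r ≫ proj r = 0
  incl_d : ∀ q r : ℕ, incl q ≫ C.d q r = 0
  incl_proj : ∀ q : ℕ, incl q ≫ proj q = 𝟙 _
  proj_class : ∀ q : ℕ, C.iCycles q ≫ proj q = C.homologyπ q
  htpy_zero : htpy 0 ≫ C.d 1 0 = proj 0 ≫ incl 0 - 𝟙 _
  htpy_succ : ∀ q : ℕ, C.d (q + 1) q ≫ htpy q + htpy (q + 1) ≫ C.d (q + 2) (q + 1) =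
    proj (q + 1) ≫ incl (q + 1) - 𝟙 _
  htpy_proj : ∀ q : ℕ, htpy q ≫ proj (q + 1) = 0
  incl_htpy : ∀ q : ℕ, incl q ≫ htpy q = 0
  htpy_htpy : ∀ q : ℕ, htpy q ≫ htpy (q + 1) = 0

namespace TransferDiagram

variable {X : TopCat.{u}} (T : TransferDiagram (singularChains k X))

/-- `proj` on total spaces. -/
def totalProj : TotalChains k X →ₗ[k] TotalHom k X :=
  DirectSum.lmap fun q => (T.proj q).hom

/-- `incl` on total spaces. -/
def totalIncl : TotalHom k X →ₗ[k] TotalChains k X :=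
  DirectSum.lmap fun q => (T.incl q).hom

/-- `htpy` on total spaces. -/
def totalHtpy : TotalChains k X →ₗ[k] TotalChains k X :=
  DirectSum.toModule k ℕ _ fun q =>
    (DirectSum.lof k ℕ (fun r => (singularChains k X).X r) (q + 1)).comp (T.htpy q).hom

end TransferDiagram

/-- The degree involution `x ↦ (-1)^{|x|} x` on chains. -/
def parity (X : TopCat.{u}) : TotalChains k X →ₗ[k] TotalChains k X :=
  DirectSum.lmap fun q => ((-1 : k) ^ q) • LinearMap.id

/-- The composite `(f ⊗ g) ∘ Δ` of the Alexander-Whitney diagonal `Δ` with the graded tensor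
product of two maps, where `g` has degree `e`; by the Koszul rule
`(f ⊗ g)(x ⊗ y) = (-1)^{e |x|} f x ⊗ g y`.  The result is read in `H^{⊗ m}`, `m = r + s`. -/
def diagonalTensor {X : TopCat.{u}} {r s m : ℕ} (h : r + s = m) (e : ℕ)
    (f : TotalChains k X →ₗ[k] ⨂[k]^r (TotalHom k X))
    (g : TotalChains k X →ₗ[k] ⨂[k]^s (TotalHom k X)) :
    TotalChains k X →ₗ[k] ⨂[k]^m (TotalHom k X) :=
  (TensorPower.cast k (TotalHom k X) h).toLinearMap ∘ₗ
    (TensorPower.mulEquiv (R := k) (M := TotalHom k X) (n := r) (m := s)).toLinearMap ∘ₗ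
      TensorProduct.map (f ∘ₗ (parity X) ^ e) g ∘ₗ awDiagonal k X

namespace TransferDiagram

variable {X : TopCat.{u}} (T : TransferDiagram (singularChains k X))

/-- The component `P_{(n+1)} : C_*(X) → H_*(X)^{⊗ (n+1)}`, of degree `n`, of the transferred
`A_∞`-morphism extending `proj`:
`P_{(1)} = proj` and
`P_{(n+2)} = (∑_{a+b=n} (-1)^b (P_{(a+1)} ⊗ P_{(b+1)}) ∘ Δ) ∘ htpy`. Unfolded, this is the sum
over planar binary trees with `Δ` at the vertices and the homotopy on the internal edges. -/
def morphismComponent : (n : ℕ) → (TotalChains k X →ₗ[k] ⨂[k]^(n + 1) (TotalHom k X))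
  | 0 => (PiTensorProduct.subsingletonEquiv (R := k) (0 : Fin 1)).symm.toLinearMap ∘ₗ T.totalProj
  | n + 1 =>
    (∑ a : Fin (n + 1), ((-1 : k) ^ (n - a.1)) •
      diagonalTensor (r := a.1 + 1) (s := n - a.1 + 1) (by omega) (n - a.1)
        (morphismComponent a.1) (morphismComponent (n - a.1))) ∘ₗ T.totalHtpy
termination_by n => n
decreasing_by all_goals omega

/-- The operations `Δ_n : H_*(X) → H_*(X)^{⊗ n}`, of degree `n - 2`, of the `A_∞`-coalgebra
structure on `H_*(X)` obtained from the Alexander-Whitney coalgebra `C_*(X)` by homotopy transfer: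
`Δ_1 = 0` and `Δ_{n+2} = (∑_{a+b=n} (-1)^b (P_{(a+1)} ⊗ P_{(b+1)}) ∘ Δ) ∘ incl`.
(The index `0` has no meaning; the value there is a filler.) -/
def Delta : (n : ℕ) → (TotalHom k X →ₗ[k] ⨂[k]^n (TotalHom k X))
  | 0 => 0
  | 1 => 0
  | n + 2 =>
    (∑ a : Fin (n + 1), ((-1 : k) ^ (n - a.1)) •
      diagonalTensor (r := a.1 + 1) (s := n - a.1 + 1) (by omega) (n - a.1)
        (T.morphismComponent a.1) (T.morphismComponent (n - a.1))) ∘ₗ T.totalIncl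

/-- The restriction of `Δ_n` to `H_q(X)`. -/
def DeltaIn (n q : ℕ) : Homology k X q →ₗ[k] ⨂[k]^n (TotalHom k X) :=
  T.Delta n ∘ₗ DirectSum.lof k ℕ (fun r => Homology k X r) q

end TransferDiagram

/-! ### Persistence of the operations along a sequence of maps -/

section Persistence

variable {N : ℕ} (K : ComposableArrows TopCat.{u} N)

/-- The map `f^{i,j} : H_q(K_i) → H_q(K_j)` induced by the composite `K_i → ⋯ → K_j`. -/
def transition {i j : Fin (N + 1)} (h : i ≤ j) (q : ℕ) :
    Homology k (K.obj i) q →ₗ[k] Homology k (K.obj j) q :=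
  homMap k (K.map (homOfLE h)) q

variable (T : ∀ i : Fin (N + 1), TransferDiagram (singularChains k (K.obj i)))

/-- The classes `α ∈ H_p(K_i)` with `Δ_n (f^{i,l} α) = 0` for all `i ≤ l ≤ j`. -/
def commonKernel (n p : ℕ) (i j : Fin (N + 1)) : Submodule k (Homology k (K.obj i) p) :=
  ⨅ (l : Fin (N + 1)) (hil : i ≤ l) (_ : l ≤ j),
    LinearMap.ker ((T l).DeltaIn n p ∘ₗ transition K hil p)

/-- The `p`-th `Δ_n`-persistent group between `K_i` and `K_j`: the image under `f^{i,j}` of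
`⋂_{l=i}^j ker (Δ_n ∘ f^{i,l})`. -/
def persistentGroup (n p : ℕ) {i j : Fin (N + 1)} (hij : i ≤ j) :
    Submodule k (Homology k (K.obj j) p) :=
  (commonKernel K T n p i j).map (transition K hij p)

/-- The class `α ∈ H_p(K_i)` is `Δ_n`-awake at `K_l`. -/
def IsAwake (n p : ℕ) {i l : Fin (N + 1)} (hil : i ≤ l) (α : Homology k (K.obj i) p) : Prop :=
  transition K hil p α ≠ 0 ∧ (T l).DeltaIn n p (transition K hil p α) = 0

variable (k) in
/-- The graded space `H(𝒦) = ⨁ i, H_*(K_i)`. -/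
abbrev TotalHomSeq : Type u := ⨁ i : Fin (N + 1), TotalHom k (K.obj i)

variable (k) in
/-- The inclusion of the summand `H_q(K_i)` into `H(𝒦)`. -/
def summandIncl (i : Fin (N + 1)) (q : ℕ) : Homology k (K.obj i) q →ₗ[k] TotalHomSeq k K :=
  DirectSum.lof k (Fin (N + 1)) (fun l => TotalHom k (K.obj l)) i ∘ₗ
    DirectSum.lof k ℕ (fun r => Homology k (K.obj i) r) q

/-- A set is a homogeneous basis of `H(𝒦)`: it is a basis, and each of its elements lies in one
of the summands `H_q(K_i)`. -/
structure IsHomogeneousBasis (B : Set (TotalHomSeq k K)) : Prop where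
  linearIndependent : LinearIndependent k (Subtype.val : B → TotalHomSeq k K)
  span_eq_top : Submodule.span k B = ⊤
  homogeneous : ∀ b ∈ B, ∃ (i : Fin (N + 1)) (q : ℕ), b ∈ LinearMap.range (summandIncl k K i q)

end Persistence

end AInfPersistence

end

/-!
For fixed `i` and `q`, the classes that stay in the kernel of `Δ_n` up to stage `j` form a
decreasing chain of subspaces `V_j` of `H_q(K_i)`, and the kernels `W_j` of `f^{i,j}` form an
increasing one. A class is awake at all stages from `i` to `j` exactly when it lies in `V_j` but
not in `W_j`, while the persistent group is the image of `V_j` under a map with kernel `W_j`.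

Two chains of subspaces of a finite-dimensional space always admit a common adapted basis
(`exists_linearIndepOn_adapted_of_isChain`): such a basis contains a basis of each member of both
chains. The members of an adapted basis in `V_j` but not in `W_j` then map to a basis of the
persistent group (`finrank_map_eq_encard_diff`). Choosing such a basis in every `H_q(K_i)` and
taking the union gives the homogeneous basis. The argument applies to any family of linear maps on
the `H_q(K_i)` in place of the `Δ_n`, since `V_j` and `W_j` form chains by construction and by
functoriality of homology.
-/

namespace AInfPersistence

/-! ### Bases adapted to two chains of subspaces -/

section LinearAlgebra

variable {k V W : Type*} [Field k] [AddCommGroup V] [Module k V] [AddCommGroup W] [Module k W]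

/-- If `H` is a hyperplane of `U` and `v ∈ U` lies outside `H`, then a set that cuts `S` in a
spanning set of `H ⊓ S` can be enlarged by `v` to one that does the same for `U ⊓ S`, provided
`v ∈ S` or `U ⊓ S ≤ H`. -/
theorem span_insert_inter_eq_inf {H U S : Submodule k V} {B : Set V} {v : V} (hHU : H ⋖ U)
    (hvU : v ∈ U) (hvH : v ∉ H) (hB : Submodule.span k (B ∩ S) = H ⊓ S)
    (hS : v ∈ S ∨ U ⊓ S ≤ H) :
    Submodule.span k (insert v B ∩ S) = U ⊓ S := by
  by_cases hvS : v ∈ S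
  · have hU : Submodule.span k {v} ⊔ H = U := by
      refine (hHU.eq_or_eq le_sup_right
        (sup_le (by simpa using hvU) hHU.le)).resolve_left fun h => hvH ?_
      rw [← h]
      exact le_sup_left (a := Submodule.span k {v}) (Submodule.mem_span_singleton_self v)
    rw [Set.insert_inter_of_mem (by simpa using hvS), Submodule.span_insert, hB,
      ← sup_inf_assoc_of_le H (by simpa using hvS), hU]
  · rw [Set.insert_inter_of_notMem (by simpa using hvS), hB]
    exact le_antisymm (inf_le_inf_right _ hHU.le)
      (le_inf (hS.resolve_left hvS) inf_le_right)

/-- Two chains `C` and `D` of subspaces of a finite-dimensional space have a common adapted basis.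
The relative version over a subspace `U` is by induction on `U`: pick a hyperplane `H` of `U`
that contains all traces of members of `C` other than `U`, and add to a basis of `H` a vector of
the smallest trace of a member of `D` that is not contained in `H`. -/
theorem exists_linearIndepOn_adapted_of_isChain [FiniteDimensional k V]
    {C D : Set (Submodule k V)} (hC : IsChain (· ≤ ·) C) (hD : IsChain (· ≤ ·) D)
    (U : Submodule k V) :
    ∃ B : Set V, LinearIndepOn k id B ∧ Submodule.span k B = U ∧
      (∀ S ∈ C, Submodule.span k (B ∩ S) = U ⊓ S) ∧
      ∀ S ∈ D, Submodule.span k (B ∩ S) = U ⊓ S := by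
  induction U using WellFoundedLT.induction with
  | ind U ih =>
  rcases eq_or_ne U ⊥ with rfl | hU
  · exact ⟨∅, linearIndepOn_empty _ _, by simp, by simp, by simp⟩
  obtain ⟨H₀, hH₀U, hH₀⟩ : ∃ H₀ < U, ∀ S ∈ C, U ≤ S ∨ U ⊓ S ≤ H₀ := by
    by_cases hne : {S ∈ C | ¬ U ≤ S}.Nonempty
    · obtain ⟨S, ⟨hSC, hSU⟩, hmax⟩ :=
        WellFounded.has_min (wellFounded_gt (α := Submodule k V)) _ hne
      refine ⟨U ⊓ S, inf_lt_left.2 hSU, fun S' hS' => or_iff_not_imp_left.2 fun hS'U => ?_⟩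
      rcases hC.total hSC hS' with h | h
      · rw [eq_of_le_of_not_lt h (hmax S' ⟨hS', hS'U⟩)]
      · exact inf_le_inf_left _ h
    · refine ⟨⊥, bot_lt_iff_ne_bot.2 hU, fun S hS => Or.inl ?_⟩
      by_contra h
      exact hne ⟨S, hS, h⟩
  obtain ⟨H, hH₀H, hHU⟩ := exists_le_covBy_of_lt hH₀U
  obtain ⟨v, hvU, hvH, hvD⟩ : ∃ v ∈ U, v ∉ H ∧ ∀ S ∈ D, v ∈ S ∨ U ⊓ S ≤ H := by
    by_cases hne : {S ∈ D | ¬ U ⊓ S ≤ H}.Nonempty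
    · obtain ⟨S, ⟨hSD, hSH⟩, hmin⟩ :=
        WellFounded.has_min (wellFounded_lt (α := Submodule k V)) _ hne
      obtain ⟨v, hv, hvH⟩ := SetLike.not_le_iff_exists.1 hSH
      refine ⟨v, hv.1, hvH, fun S' hS' => or_iff_not_imp_right.2 fun hS'H => ?_⟩
      rcases hD.total hSD hS' with h | h
      · exact h hv.2
      · rw [eq_of_le_of_not_lt h (hmin S' ⟨hS', hS'H⟩)]
        exact hv.2
    · obtain ⟨v, hv, hvH⟩ := SetLike.exists_of_lt hHU.lt
      refine ⟨v, hv, hvH, fun S hS => Or.inr ?_⟩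
      by_contra h
      exact hne ⟨S, hS, h⟩
  obtain ⟨B, hB, hBH, hBC, hBD⟩ := ih H hHU.lt
  refine ⟨insert v B, hB.id_insert (by rwa [hBH]), ?_, fun S hS => ?_, fun S hS => ?_⟩
  · simpa using span_insert_inter_eq_inf (S := ⊤) hHU hvU hvH (by simpa using hBH)
      (Or.inl trivial)
  · exact span_insert_inter_eq_inf hHU hvU hvH (hBC S hS)
      ((hH₀ S hS).imp (fun h => h hvU) fun h => h.trans hH₀H)
  · exact span_insert_inter_eq_inf hHU hvU hvH (hBD S hS) (hvD S hS)

/-- If a linearly independent set `B` contains bases of a subspace `S` and of `ker f`, then the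
elements of `B` in `S` but not in `ker f` map to a basis of `f(S)`. -/
theorem finrank_map_eq_encard_diff [FiniteDimensional k V] {B : Set V}
    (hB : LinearIndepOn k id B) {S : Submodule k V} {f : V →ₗ[k] W}
    (hS : Submodule.span k (B ∩ S) = S)
    (hf : Submodule.span k (B ∩ LinearMap.ker f) = LinearMap.ker f) :
    (Module.finrank k (S.map f) : ℕ∞) = ((B ∩ S) \ LinearMap.ker f).encard := by
  set A : Set V := (B ∩ S) \ LinearMap.ker f
  have hAB : A ⊆ B := fun x hx => hx.1.1
  have hA : LinearIndepOn k id A := hB.mono hAB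
  have hdisj : Disjoint (Submodule.span k A) (LinearMap.ker f) := by
    rw [← hf]
    have := hB.disjoint_span_image (s := ((↑) : B → V) ⁻¹' A)
      (t := ((↑) : B → V) ⁻¹' (B ∩ LinearMap.ker f)) <| by
        rw [Set.disjoint_left]
        exact fun x hx hx' => hx.2 hx'.2
    simpa [Set.image_preimage_eq_inter_range, Function.comp_def,
      Set.inter_eq_left.2 hAB, Set.inter_right_comm B _ B] using this
  have hfA : LinearIndependent k fun x : A => f x :=
    hA.map (by simpa [Function.comp_def] using hdisj)
  have hspan : Submodule.span k (Set.range fun x : A => f x) = S.map f := by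
    refine le_antisymm (Submodule.span_le.2 ?_) ?_
    · rintro _ ⟨x, rfl⟩
      exact ⟨x, x.2.1.2, rfl⟩
    · conv_lhs => rw [← hS]
      rw [Submodule.map_span_le]
      intro x hx
      by_cases hxf : x ∈ LinearMap.ker f
      · rw [LinearMap.mem_ker.1 hxf]
        exact zero_mem _
      · exact Submodule.subset_span ⟨⟨x, hx, hxf⟩, rfl⟩
  have : Finite A := hA.finite
  have := Fintype.ofFinite A
  rw [← hspan, finrank_span_eq_card hfA, Set.encard, ENat.card_eq_coe_fintype_card]

/-- Linearly independent families in the summands of a direct sum combine to one in the sum. -/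
theorem linearIndependent_sigma_lof {ι : Type*} [DecidableEq ι] {κ : ι → Type*} {M : ι → Type*}
    [∀ i, AddCommMonoid (M i)] [∀ i, Module k (M i)] {v : ∀ i, κ i → M i}
    (hv : ∀ i, LinearIndependent k (v i)) :
    LinearIndependent k fun a : Σ i, κ i => DirectSum.lof k ι M a.1 (v a.1 a.2) :=
  DFinsupp.linearIndependent_single _ hv

end LinearAlgebra

/-! ### Homogeneous bases of the graded space -/

section Persistence

variable {k : Type u} [Field k] {N : ℕ} (K : ComposableArrows TopCat.{u} N)

theorem eq_of_summandIncl_eq {i i' : Fin (N + 1)} {q q' : ℕ} {x : Homology k (K.obj i) q}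
    {x' : Homology k (K.obj i') q'} (hx : x ≠ 0)
    (h : summandIncl k K i q x = summandIncl k K i' q' x') :
    (⟨i, q, x⟩ : Σ (i : Fin (N + 1)) (q : ℕ), Homology k (K.obj i) q) = ⟨i', q', x'⟩ := by
  have hi : i = i' := by
    by_contra hne
    have h1 := congrArg (fun z => z i) h
    simp only [summandIncl, LinearMap.comp_apply, DirectSum.lof_eq_of] at h1
    rw [DirectSum.of_eq_same, DirectSum.of_eq_of_ne _ _ _ hne] at h1
    exact hx (DirectSum.of_injective (β := fun r => Homology k (K.obj i) r) q
      (h1.trans (map_zero _).symm))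
  subst hi
  have h1 := DirectSum.of_injective (β := fun l => TotalHom k (K.obj l)) i h
  have hq : q = q' := by
    by_contra hne
    have h2 := congrArg (fun z => z q) h1
    simp only [DirectSum.lof_eq_of] at h2
    rw [DirectSum.of_eq_same, DirectSum.of_eq_of_ne _ _ _ hne] at h2
    exact hx h2
  subst hq
  rw [DirectSum.of_injective (β := fun r => Homology k (K.obj i) r) q h1]

/-- The union of bases of the summands `H_q(K_i)` is a homogeneous basis. -/
theorem isHomogeneousBasis_iUnion
    {B : ∀ (i : Fin (N + 1)) (q : ℕ), Set (Homology k (K.obj i) q)}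
    (hli : ∀ i q, LinearIndepOn k id (B i q)) (hspan : ∀ i q, Submodule.span k (B i q) = ⊤) :
    IsHomogeneousBasis K (⋃ i, ⋃ q, summandIncl k K i q '' B i q) := by
  let c (a : Σ (i : Fin (N + 1)) (q : ℕ), B i q) : TotalHomSeq k K :=
    summandIncl k K a.1 a.2.1 a.2.2
  have hc : LinearIndependent k c :=
    linearIndependent_sigma_lof (κ := fun i => Σ q : ℕ, B i q)
      (M := fun i => TotalHom k (K.obj i))
      (v := fun i a => DirectSum.lof k ℕ (fun q => Homology k (K.obj i) q) a.1 a.2.1) fun i =>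
        linearIndependent_sigma_lof (M := fun q => Homology k (K.obj i) q)
          (v := fun q (x : B i q) => x.1) fun q => hli i q
  have hrange : (⋃ i, ⋃ q, summandIncl k K i q '' B i q) = Set.range c := by
    ext x
    simp only [Set.mem_iUnion, Set.mem_image, Set.mem_range, c]
    constructor
    · rintro ⟨i, q, y, hy, rfl⟩
      exact ⟨⟨i, q, y, hy⟩, rfl⟩
    · rintro ⟨⟨i, q, y⟩, rfl⟩
      exact ⟨i, q, y, y.2, rfl⟩
  refine ⟨?_, ?_, ?_⟩
  · rw [hrange]
    exact hc.linearIndepOn_id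
  · have hmem (i : Fin (N + 1)) (q : ℕ) (x : Homology k (K.obj i) q) : summandIncl k K i q x ∈
        Submodule.span k (⋃ i, ⋃ q, summandIncl k K i q '' B i q) := by
      have hx : summandIncl k K i q x ∈ Submodule.span k (summandIncl k K i q '' B i q) := by
        rw [Submodule.span_image, hspan]
        exact Submodule.mem_map_of_mem trivial
      exact Submodule.span_mono
        (Set.subset_iUnion_of_subset i
          (Set.subset_iUnion (fun q => summandIncl k K i q '' B i q) q)) hx
    rw [eq_top_iff]
    rintro x -
    induction x using DirectSum.induction_on with
    | zero => exact zero_mem _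
    | add x y hx hy => exact add_mem hx hy
    | of i x =>
      induction x using DirectSum.induction_on with
      | zero => simp
      | add x y hx hy =>
        rw [map_add]
        exact add_mem hx hy
      | of q x => exact hmem i q x
  · intro x hx
    simp only [Set.mem_iUnion] at hx
    obtain ⟨i, q, y, -, rfl⟩ := hx
    exact ⟨i, q, y, rfl⟩

theorem summandIncl_mem_iUnion_iff
    {B : ∀ (i : Fin (N + 1)) (q : ℕ), Set (Homology k (K.obj i) q)}
    (hli : ∀ i q, LinearIndepOn k id (B i q)) {i : Fin (N + 1)} {q : ℕ}
    {x : Homology k (K.obj i) q} :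
    summandIncl k K i q x ∈ (⋃ i, ⋃ q, summandIncl k K i q '' B i q) ↔ x ∈ B i q := by
  simp only [Set.mem_iUnion]
  constructor
  · rintro ⟨i', q', y, hy, h⟩
    have hy0 : y ≠ 0 := (hli i' q').ne_zero hy
    cases eq_of_summandIncl_eq K hy0 h
    exact hy
  · exact fun hx => ⟨i, q, x, hx, rfl⟩

/-! ### The two chains of a persistence module -/

theorem transition_trans {i j l : Fin (N + 1)} (hij : i ≤ j) (hjl : j ≤ l) (q : ℕ)
    (x : Homology k (K.obj i) q) :
    transition K (hij.trans hjl) q x = transition K hjl q (transition K hij q x) := by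
  simp only [transition, homMap]
  rw [← LinearMap.comp_apply, ← ModuleCat.hom_comp, ← HomologicalComplex.homologyMap_comp,
    ← Functor.map_comp, ← Functor.map_comp, homOfLE_comp]

theorem ker_transition_mono {i j l : Fin (N + 1)} (hij : i ≤ j) (hjl : j ≤ l) (q : ℕ) :
    LinearMap.ker (transition (k := k) K hij q) ≤
      LinearMap.ker (transition K (hij.trans hjl) q) := by
  intro x hx
  rw [LinearMap.mem_ker] at hx ⊢
  rw [transition_trans K hij hjl, hx, map_zero]

variable (T : ∀ i : Fin (N + 1), TransferDiagram (singularChains k (K.obj i)))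

theorem commonKernel_antitone (n q : ℕ) (i : Fin (N + 1)) : Antitone (commonKernel K T n q i) :=
  fun _ _ hjl => iInf_mono fun _ => iInf_mono fun _ => iInf_mono' fun h => ⟨h.trans hjl, le_rfl⟩

theorem forall_isAwake_iff (n q : ℕ) {i j : Fin (N + 1)} (hij : i ≤ j)
    (x : Homology k (K.obj i) q) :
    (∀ (l : Fin (N + 1)) (hil : i ≤ l), l ≤ j → IsAwake K T n q hil x) ↔
      x ∈ commonKernel K T n q i j ∧ x ∉ LinearMap.ker (transition K hij q) := by
  simp only [commonKernel, Submodule.mem_iInf, IsAwake]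
  constructor
  · exact fun h => ⟨fun l hil hlj => (h l hil hlj).2, (h j hij le_rfl).1⟩
  · exact fun h l hil hlj =>
      ⟨fun h0 => h.2 (ker_transition_mono K hil hlj q h0), h.1 l hil hlj⟩

end Persistence

end AInfPersistence

theorem theorem2p1 {k : Type u} [Field k] {N : ℕ} (K : ComposableArrows TopCat.{u} N)
    (hfin : ∀ (i : Fin (N + 1)) (q : ℕ), Module.Finite k (AInfPersistence.Homology k (K.obj i) q))
    (T : ∀ i : Fin (N + 1),
      AInfPersistence.TransferDiagram (AInfPersistence.singularChains k (K.obj i)))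
    (n : ℕ) (hn : 1 ≤ n) (p : ℕ) :
    ∃ B : Set (AInfPersistence.TotalHomSeq k K), AInfPersistence.IsHomogeneousBasis K B ∧
      ∀ (i j : Fin (N + 1)) (hij : i ≤ j),
        (Module.finrank k (AInfPersistence.persistentGroup K T n p hij) : ℕ∞) =
          Set.encard {β : AInfPersistence.Homology k (K.obj i) p |
            AInfPersistence.summandIncl k K i p β ∈ B ∧
              ∀ (l : Fin (N + 1)) (hil : i ≤ l), l ≤ j →
                AInfPersistence.IsAwake K T n p hil β} := by
  have key (i : Fin (N + 1)) (q : ℕ) := by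
    have := hfin i q
    exact AInfPersistence.exists_linearIndepOn_adapted_of_isChain
      (C := Set.range (AInfPersistence.commonKernel K T n q i))
      (D := Set.range fun j : Set.Ici i =>
        LinearMap.ker (AInfPersistence.transition (k := k) K j.2 q))
      (AInfPersistence.commonKernel_antitone K T n q i).isChain_range
      (Monotone.isChain_range fun j _ hjl => AInfPersistence.ker_transition_mono K j.2 hjl q) ⊤
  choose B hli hspan hC hD using key
  refine ⟨_, AInfPersistence.isHomogeneousBasis_iUnion K hli hspan, fun i j hij => ?_⟩
  have := hfin i p
  rw [AInfPersistence.persistentGroup, AInfPersistence.finrank_map_eq_encard_diff (hli i p)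
    (by simpa using hC i p _ ⟨j, rfl⟩) (by simpa using hD i p _ ⟨⟨j, hij⟩, rfl⟩)]
  congr 1
  ext x
  simp only [Set.mem_ofPred_eq, AInfPersistence.summandIncl_mem_iUnion_iff K hli,
    AInfPersistence.forall_isAwake_iff K T n p hij, Set.mem_sdiff, Set.mem_inter_iff,
    SetLike.mem_coe, and_assoc]
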